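/- Let $X$ be a real Hausdorff locally convex topological vector space, let $K\subseteq X$ be nonempty, convex and compact, and let $D\subseteq K$ be self segment-dense in $K$, i.e. $D$ is dense in $K$ and for all $x,y\in D$ the set $[x,y]\cap D$ is dense in the closed segment $[x,y]$. Let $F:K\times K\rightrightarrows\mathbb R$ be a set-valued map (values are subsets of $\mathbb R$, possibly empty). A set-valued map $T:K\rightrightarrows\mathbb R$ is called upper semicontinuous at $x\in K$ if for every open $N\subseteq\mathbb R$ with $T(x)\subseteq N$ there is a neighbourhood $M$ of $x$ in $K$ with $T(z)\subseteq N$ for all $z\in M$; it is called concave on $D$ if for all $n\ge 1$, $y_1,\dots,y_n\in D$ and $\lambda_1,\dots,\lambda_n\ge 0$ with $\sum_i\lambda_i=1$ and $\sum_i\lambda_i y_i\in D$ one has $T\big(\sum_i\lambda_i y_i\big)\subseteq\sum_i\lambda_i T(y_i)$ (Minkowski sum). Assume that 1. for every $y\in D$, the map $x\mapsto F(x,y)$ is upper semicontinuous at every point of $K$; 2. for every $x\in K$, the map $y\mapsto F(x,y)$ is upper semicontinuous at every point of $K\setminus D$; 3. for every $x\in D$, the map $y\mapsto F(x,y)$ is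 concave on $D$; 4. for every $x\in D$, $F(x,x)\cap[0,\infty)\neq\emptyset$. Then there exists $x_0\in K$ such that $F(x_0,y)\cap[0,\infty)\neq\emptyset$ for all $y\in K$. -/

import Mathlib

open Set
open scoped Pointwise

/-- `U` is self segment-dense in `V`: it is a dense subset of `V`, and for any two points of `U`
the closed segment joining them has a dense set of points in `U`.
(The set `V` is meant to be convex.) -/
def SelfSegmentDense {E : Type*} [AddCommGroup E] [Module ℝ E] [TopologicalSpace E]
    (U V : Set E) : Prop :=
  U ⊆ V ∧ V ⊆ closure U ∧
    ∀ x ∈ U, ∀ y ∈ U, segment ℝ x y ⊆ closure (segment ℝ x y ∩ U)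

/-- A set-valued map `T` with values in the subsets of `ℝ` is concave on a (not necessarily convex)
set `D`: whenever a convex combination of points of `D` lies in `D`, the value there is contained
in the corresponding combination (Minkowski sum of dilated sets) of the values. -/
def SetValuedConcaveOn {E : Type*} [AddCommGroup E] [Module ℝ E]
    (D : Set E) (T : E → Set ℝ) : Prop :=
  ∀ (n : ℕ) (x : Fin n → E) (l : Fin n → ℝ),
    (∀ i, x i ∈ D) → (∀ i, 0 ≤ l i) → ∑ i, l i = 1 → ∑ i, l i • x i ∈ D →
      T (∑ i, l i • x i) ⊆ ∑ i, l i • T (x i)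

/-! For `y ∈ D` let `G y` be the set of `x ∈ K` where `F x y` meets `[0, ∞)`; upper semicontinuity
in `x` makes it closed. If finitely many points of `D` span a polytope, the diagonal condition and
concavity put each point of the polytope lying in `D` into some `G y`. Self segment-density makes
those points dense in the polytope, and a finite union of closed sets is closed, so the `G y` form a
KKM family. The KKM principle and compactness of `K` give `x₀` in every `G y`, `y ∈ D`; upper
semicontinuity in `y` carries this to `K \ D`.

KKM itself comes from Scarf's lemma, a parity argument on finitely many linear orders, applied to
ever finer grids in the simplex; a compactness limit follows. -/

/-! ### Parity counting and Scarf's lemma -/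

open Finset in
/-- If `f` identifies exactly one pair of points of `s`, then erasing a point preserves the image
for exactly two points of `s`. -/
theorem Finset.exists_pair_image_erase {α β : Type*} [DecidableEq α] [DecidableEq β]
    (s : Finset α) (f : α → β) (h : (s.image f).card + 1 = s.card) :
    ∃ a ∈ s, ∃ b ∈ s, a ≠ b ∧ f a = f b ∧
      ∀ x ∈ s, (s.erase x).image f = s.image f ↔ x = a ∨ x = b := by
  obtain ⟨a, ha, b, hb, hab, hf⟩ :=
    exists_ne_map_eq_of_card_lt_of_maps_to (s := s) (t := s.image f) (f := f) (by omega)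
      (fun x hx => mem_image_of_mem f hx)
  have key : ∀ a ∈ s, ∀ b ∈ s, a ≠ b → f a = f b → (s.erase a).image f = s.image f := by
    intro a ha b hb hab hf
    apply subset_antisymm (image_subset_image (erase_subset _ _))
    intro y hy
    obtain ⟨x, hx, rfl⟩ := Finset.mem_image.1 hy
    by_cases hxa : x = a
    · subst hxa
      rw [hf]
      exact mem_image_of_mem f (Finset.mem_erase.2 ⟨hab.symm, hb⟩)
    · exact mem_image_of_mem f (Finset.mem_erase.2 ⟨hxa, hx⟩)
  refine ⟨a, ha, b, hb, hab, hf, fun x hx => ⟨fun hi => ?_, ?_⟩⟩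
  · by_contra! hne
    have hinj : Set.InjOn f (s.erase x : Finset α) := by
      rw [← card_image_iff, hi, card_erase_of_mem hx]
      omega
    exact hab (hinj (by simpa using ⟨ha, hne.1.symm⟩) (by simpa using ⟨hb, hne.2.symm⟩) hf)
  · rintro (rfl | rfl)
    · exact key x ha b hb hab hf
    · exact key x hb a ha hab.symm hf.symm

/-- A set `S` is dominant for the family of orders induced by `r` if no point is strictly above
the minimum of `S` in every order. -/
def IsDominant {I V L : Type*} [LinearOrder L] (r : I → V → L) (S : Finset V) : Prop :=
  ∀ y, ∃ i, ∀ x ∈ S, r i y ≤ r i x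

theorem IsDominant.mono {I V L : Type*} [LinearOrder L] {r : I → V → L} {S T : Finset V}
    (h : IsDominant r S) (hT : T ⊆ S) : IsDominant r T := fun y =>
  (h y).imp fun _ hi x hx => hi x (hT hx)

open Finset in
/-- A nonempty set with one point fewer than there are orders lies in an even number of dominant
sets with as many points as orders, provided none of its sides is exposed. -/
theorem even_card_dominant_supersets {I V L : Type*} [LinearOrder L] [Fintype I] [Fintype V]
    [DecidableEq I] [DecidableEq V] (r : I → V → L) (hr : ∀ i, Function.Injective (r i))
    (t : Finset V) (ht : t.Nonempty) (hcard : t.card + 1 = Fintype.card I)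
    (hM : ∀ j, ∃ y, ∀ i, i ≠ j → ∃ x ∈ t, r i x < r i y)
    (R : Finset (Finset V))
    (hR : ∀ S, S ∈ R ↔ IsDominant r S ∧ S.card = Fintype.card I) :
    Even (R.filter (fun S => t ⊆ S)).card := by
  classical
  by_cases hdom : IsDominant r t
  swap
  · rw [filter_eq_empty_iff.2 fun S hS hts => hdom (((hR S).1 hS).1.mono hts)]
    simp
  have hm : ∀ i, ∃ x ∈ t, ∀ z ∈ t, r i x ≤ r i z := fun i => t.exists_min_image (r i) ht
  choose m hmt hmin using hm
  have hminlt : ∀ {i y}, (∃ x ∈ t, r i x < r i y) ↔ r i (m i) < r i y := fun {i y} =>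
    ⟨fun ⟨x, hx, h⟩ => (hmin i x hx).trans_lt h, fun h => ⟨_, hmt i, h⟩⟩
  simp_rw [hminlt] at hM
  -- Dominance at a point of `t` makes it the minimum of `t` in some order. With one more order than
  -- points, exactly two indices `a`, `b` share a minimiser.
  have himg : (Finset.univ : Finset I).image m = t := by
    apply subset_antisymm
    · intro y hy
      obtain ⟨i, -, rfl⟩ := Finset.mem_image.1 hy
      exact hmt i
    · intro y hy
      obtain ⟨i, hi⟩ := hdom y
      refine Finset.mem_image.2 ⟨i, Finset.mem_univ _, ?_⟩
      exact hr i (le_antisymm (hmin i y hy) (hi _ (hmt i)))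
  obtain ⟨a, -, b, -, hab, hmab, hiff⟩ := exists_pair_image_erase (Finset.univ : Finset I) m
    (by rw [himg, hcard, card_univ])
  rw [himg] at hiff
  -- An added vertex must take over as minimum in one order `j`, the other orders still reaching all
  -- of `t`; so `j` is `a` or `b`, and the vertex is the `r j`-highest candidate.
  have hx : ∀ j, ∃ x, (∀ i, i ≠ j → r i (m i) < r i x) ∧
      ∀ y, (∀ i, i ≠ j → r i (m i) < r i y) → r j y ≤ r j x := by
    intro j
    obtain ⟨y, hy⟩ := hM j
    obtain ⟨x, hx, hmax⟩ := (Finset.univ.filter fun y => ∀ i, i ≠ j → r i (m i) < r i y).exists_max_image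
      (r j) ⟨y, by simpa using hy⟩
    exact ⟨x, by simpa using hx, fun y hy => hmax y (by simpa using hy)⟩
  choose x hx1 hx2 using hx
  have hxle : ∀ j, r j (x j) ≤ r j (m j) := by
    intro j
    obtain ⟨i, hi⟩ := hdom (x j)
    by_cases hij : i = j
    · subst hij; exact hi _ (hmt i)
    · exact absurd (hx1 j i hij) (not_lt.2 (hi _ (hmt i)))
  have hxdom : ∀ j, IsDominant r (insert (x j) t) := by
    intro j y
    by_cases hy : ∀ i, i ≠ j → r i (m i) < r i y
    · refine ⟨j, fun z hz => ?_⟩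
      rcases Finset.mem_insert.1 hz with rfl | hz
      · exact hx2 j y hy
      · exact (hx2 j y hy).trans ((hxle j).trans (hmin j z hz))
    · push Not at hy
      obtain ⟨i, hij, hi⟩ := hy
      refine ⟨i, fun z hz => ?_⟩
      rcases Finset.mem_insert.1 hz with rfl | hz
      · exact hi.trans (hx1 j i hij).le
      · exact hi.trans (hmin i z hz)
  have hxt : ∀ j, j = a ∨ j = b → x j ∉ t := by
    intro j hj hmem
    rw [← (hiff j (Finset.mem_univ _)).2 hj] at hmem
    obtain ⟨i, hi, hix⟩ := Finset.mem_image.1 hmem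
    have := hx1 j i (Finset.mem_erase.1 hi).1
    rw [hix] at this
    exact lt_irrefl _ this
  have hne : insert (x a) t ≠ insert (x b) t := by
    intro h
    have h1 : x a ∈ insert (x b) t := h ▸ Finset.mem_insert_self _ _
    rcases Finset.mem_insert.1 h1 with h1 | h1
    · have h2 := hx1 a b hab.symm
      rw [h1] at h2
      exact absurd (hxle b) (not_le.2 h2)
    · exact hxt a (Or.inl rfl) h1
  have hset : R.filter (fun S => t ⊆ S) = {insert (x a) t, insert (x b) t} := by
    ext S
    simp only [mem_filter, Finset.mem_insert, Finset.mem_singleton, hR]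
    constructor
    · rintro ⟨⟨hS, hSc⟩, htS⟩
      obtain ⟨z, hz⟩ : ∃ z, S \ t = {z} := by
        rw [← card_eq_one, card_sdiff_of_subset htS]; omega
      have hzS : z ∈ S \ t := by rw [hz]; exact Finset.mem_singleton_self z
      have hSz : S = insert z t := by
        rw [← Finset.union_sdiff_of_subset htS, hz, Finset.union_comm]; rfl
      obtain ⟨j, hj⟩ := hS z
      have hzt := (Finset.mem_sdiff.1 hzS).2
      -- the indices whose minimum over `S` lies in `t`
      set J : Finset I := Finset.univ.filter fun i => ∃ y ∈ t, ∀ w ∈ S, r i y ≤ r i w with hJ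
      have hjJ : j ∉ J := by
        intro h
        obtain ⟨y, hy, hyS⟩ := (mem_filter.1 h).2
        have := hr j (le_antisymm (hj y (htS hy)) (hyS z (Finset.mem_sdiff.1 hzS).1))
        exact hzt (this ▸ hy)
      have hmJ : ∀ i ∈ J, ∀ w ∈ S, r i (m i) ≤ r i w := by
        intro i hi w hw
        obtain ⟨y, hy, hyS⟩ := (mem_filter.1 hi).2
        exact (hmin i y hy).trans (hyS w hw)
      have htJ : t ⊆ J.image m := by
        intro y hy
        obtain ⟨i, hi⟩ := hS y
        refine Finset.mem_image.2 ⟨i, mem_filter.2 ⟨Finset.mem_univ _, y, hy, hi⟩, ?_⟩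
        exact hr i (le_antisymm (hmin i y hy) (hi _ (htS (hmt i))))
      have hJe : J = Finset.univ.erase j := by
        refine Finset.eq_of_subset_of_card_le (subset_erase.2 ⟨Finset.subset_univ _, hjJ⟩) ?_
        rw [card_erase_of_mem (Finset.mem_univ _), card_univ]
        have := (Finset.card_le_card htJ).trans card_image_le
        omega
      have hjab := (hiff j (Finset.mem_univ _)).1 (by
        rw [← hJe]
        exact subset_antisymm ((image_subset_image (Finset.subset_univ _)).trans himg.le) htJ)
      have hzM : ∀ i, i ≠ j → r i (m i) < r i z := by
        intro i hi
        refine lt_of_le_of_ne (hmJ i (by simp [hJe, hi]) z (Finset.mem_sdiff.1 hzS).1) fun h => ?_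
        exact hzt (hr i h ▸ hmt i)
      have hzx : z = x j := by
        refine hr j (le_antisymm (hx2 j z hzM) ?_)
        obtain ⟨i, hi⟩ := hS (x j)
        by_cases hij : i = j
        · subst hij; exact hi z (Finset.mem_sdiff.1 hzS).1
        · exact absurd (hx1 j i hij) (not_lt.2 (hi _ (htS (hmt i))))
      rcases hjab with rfl | rfl
      · left; rw [hSz, hzx]
      · right; rw [hSz, hzx]
    · rintro (rfl | rfl)
      · exact ⟨⟨hxdom a, by rw [card_insert_of_notMem (hxt a (Or.inl rfl)), hcard]⟩,
          Finset.subset_insert _ _⟩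
      · exact ⟨⟨hxdom b, by rw [card_insert_of_notMem (hxt b (Or.inr rfl)), hcard]⟩,
          Finset.subset_insert _ _⟩
  rw [hset, card_pair hne]
  exact even_two

open Finset in
/-- A set with as many points as there are colours, but missing some colour, has an even number
of facets carrying exactly the colours other than `k`. -/
theorem even_card_facets_image_erase {I V : Type*} [Fintype I] [DecidableEq I] [DecidableEq V]
    (c : V → I) (k : I) (S : Finset V) (hS : S.card = Fintype.card I) (hc : S.image c ≠ Finset.univ)
    (A : Finset (Finset V))
    (hA : ∀ t, t ∈ A ↔ t.card + 1 = Fintype.card I ∧ t.image c = Finset.univ.erase k) :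
    Even (A.filter (fun t => t ⊆ S)).card := by
  classical
  by_cases h0 : A.filter (fun t => t ⊆ S) = ∅
  · simp [h0]
  obtain ⟨t0, ht0⟩ := nonempty_iff_ne_empty.2 h0
  obtain ⟨ht0A, ht0S⟩ := mem_filter.1 ht0
  obtain ⟨-, hc0⟩ := (hA t0).1 ht0A
  have hI : 0 < Fintype.card I := Fintype.card_pos_iff.2 ⟨k⟩
  have hce : S.image c = Finset.univ.erase k := by
    have h1 : Finset.univ.erase k ⊆ S.image c := hc0 ▸ image_subset_image ht0S
    refine (Finset.eq_of_subset_of_card_le h1 ?_).symm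
    have := Finset.card_lt_card (ssubset_univ_iff.2 hc)
    rw [card_erase_of_mem (Finset.mem_univ _)]
    rw [card_univ] at *
    omega
  obtain ⟨a, ha, b, hb, hab, -, hiff⟩ := exists_pair_image_erase S c (by
    rw [hce, card_erase_of_mem (Finset.mem_univ _), card_univ]; omega)
  have hset : A.filter (fun t => t ⊆ S) = {S.erase a, S.erase b} := by
    ext t
    simp only [mem_filter, Finset.mem_insert, Finset.mem_singleton, hA]
    constructor
    · rintro ⟨⟨h1, h2⟩, h3⟩
      obtain ⟨z, hz⟩ : ∃ z, S \ t = {z} := by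
        rw [← card_eq_one, card_sdiff_of_subset h3]; omega
      have ht : t = S.erase z := by
        rw [← sdiff_singleton_eq_erase, ← hz, Finset.sdiff_sdiff_eq_self h3]
      have hzS : z ∈ S := (Finset.mem_sdiff.1 (hz ▸ Finset.mem_singleton_self z : z ∈ S \ t)).1
      rcases (hiff z hzS).1 (by rw [← ht, h2, hce]) with rfl | rfl
      · exact Or.inl ht
      · exact Or.inr ht
    · rintro (rfl | rfl)
      · exact ⟨⟨by rw [card_erase_of_mem ha]; omega, ((hiff a ha).2 (Or.inl rfl)).trans hce⟩,
          erase_subset _ _⟩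
      · exact ⟨⟨by rw [card_erase_of_mem hb]; omega, ((hiff b hb).2 (Or.inr rfl)).trans hce⟩,
          erase_subset _ _⟩
  rw [hset, card_pair]
  · exact even_two
  · intro h
    have : a ∈ S.erase b := Finset.mem_erase.2 ⟨hab, ha⟩
    rw [← h] at this
    simp at this

open Finset in
/-- **Scarf's lemma**: given slack vertices `s i`, there is a dominant set carrying all colours. -/
theorem exists_dominant_image_eq_univ {I V L : Type*} [LinearOrder L] [Fintype I] [Nonempty I]
    [Fintype V] [DecidableEq I] (r : I → V → L)
    (hr : ∀ i, Function.Injective (r i)) (s : I → V) (c : V → I) (hcs : ∀ i, c (s i) = i)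
    (hbot : ∀ i v, r i (s i) ≤ r i v)
    (htop : ∀ i j v, i ≠ j → v ∉ range s → r i v < r i (s j)) (v₀ : V) (hv₀ : v₀ ∉ range s) :
    ∃ S : Finset V, IsDominant r S ∧ S.image c = Finset.univ := by
  classical
  by_contra! hcon
  obtain ⟨k⟩ := ‹Nonempty I›
  have hI : 0 < Fintype.card I := Fintype.card_pos_iff.2 ⟨k⟩
  have hsinj : Function.Injective s := Function.LeftInverse.injective hcs
  set R : Finset (Finset V) := Finset.univ.filter fun S => IsDominant r S ∧ S.card = Fintype.card I
  set A : Finset (Finset V) :=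
    Finset.univ.filter fun t => t.card + 1 = Fintype.card I ∧ t.image c = Finset.univ.erase k
  have hR : ∀ S, S ∈ R ↔ IsDominant r S ∧ S.card = Fintype.card I := by simp [R]
  have hA : ∀ t, t ∈ A ↔ t.card + 1 = Fintype.card I ∧ t.image c = Finset.univ.erase k := by simp [A]
  -- Inclusions of facets `t ∈ A` in sets `S ∈ R` are counted both ways: evenly many for each `S`,
  -- and evenly many for each `t` except the all-slack facet `t₀`, which contributes one.
  have hcount := sum_card_bipartiteAbove_eq_sum_card_bipartiteBelow
    (s := A) (t := R) (fun t S => t ⊆ S)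
  have hright : Even (∑ S ∈ R, #(A.bipartiteBelow (fun t S => t ⊆ S) S)) :=
    Finset.even_sum _ fun S hS => even_card_facets_image_erase c k S ((hR S).1 hS).2
      (hcon S ((hR S).1 hS).1) A hA
  set t₀ : Finset V := (Finset.univ.erase k).image s with ht₀
  have ht₀A : t₀ ∈ A := by
    rw [hA, ht₀, Finset.card_image_of_injective _ hsinj, card_erase_of_mem (Finset.mem_univ _), card_univ,
      Finset.image_image]
    refine ⟨by omega, ?_⟩
    have : c ∘ s = id := funext hcs
    rw [this, Finset.image_id]
  have hodd : #(R.bipartiteAbove (fun t S => t ⊆ S) t₀) = 1 := by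
    have hmem : ∀ i, i ≠ k → s i ∈ t₀ := fun i hi => mem_image_of_mem s (by simp [hi])
    obtain ⟨x, hx, hmax⟩ := (Finset.univ \ t₀).exists_max_image (r k) ⟨v₀, by
      simp only [Finset.mem_sdiff, Finset.mem_univ, true_and, ht₀, Finset.mem_image, not_exists, not_and]
      exact fun i _ h => hv₀ ⟨i, h⟩⟩
    have hxt : x ∉ t₀ := (Finset.mem_sdiff.1 hx).2
    -- For `i ≠ k` the bottom of order `i` is already in `t₀`, so only order `k` matters and its
    -- highest point outside `t₀` is the unique completion.
    have hdomk : ∀ S : Finset V, t₀ ⊆ S → ∀ y ∉ t₀, ∀ i, (∀ w ∈ S, r i y ≤ r i w) → i = k := by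
      intro S hS y hy i hi
      by_contra hik
      have := hr i (le_antisymm (hi _ (hS (hmem i hik))) (hbot i y))
      exact hy (this ▸ hmem i hik)
    rw [card_eq_one]
    refine ⟨insert x t₀, ?_⟩
    ext S
    simp only [mem_bipartiteAbove, Finset.mem_singleton, hR]
    have ht₀c := ((hA t₀).1 ht₀A).1
    constructor
    · rintro ⟨⟨hS, hSc⟩, htS⟩
      obtain ⟨z, hz⟩ : ∃ z, S \ t₀ = {z} := by
        rw [← card_eq_one, card_sdiff_of_subset htS]; omega
      have hzS : z ∈ S \ t₀ := by rw [hz]; exact Finset.mem_singleton_self z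
      have hSz : S = insert z t₀ := by
        rw [← Finset.union_sdiff_of_subset htS, hz, Finset.union_comm]; rfl
      obtain ⟨i, hi⟩ := hS x
      have hik := hdomk S htS x hxt i hi
      subst hik
      have : x = z := hr i (le_antisymm (hi z (Finset.mem_sdiff.1 hzS).1)
        (hmax z (by simpa using (Finset.mem_sdiff.1 hzS).2)))
      rw [hSz, this]
    · rintro rfl
      refine ⟨⟨fun y => ?_, by rw [card_insert_of_notMem hxt, ht₀c]⟩, Finset.subset_insert _ _⟩
      by_cases hy : y ∈ t₀
      · obtain ⟨i, -, rfl⟩ := Finset.mem_image.1 hy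
        exact ⟨i, fun w _ => hbot i w⟩
      · refine ⟨k, fun w hw => ?_⟩
        have hyx : r k y ≤ r k x := hmax y (by simpa using hy)
        rcases Finset.mem_insert.1 hw with rfl | hw
        · exact hyx
        · obtain ⟨j, hj, rfl⟩ := Finset.mem_image.1 hw
          have hjk : j ≠ k := (Finset.mem_erase.1 hj).1
          by_cases hxs : x ∈ range s
          · obtain ⟨i, rfl⟩ := hxs
            have : i = k := by
              by_contra hik
              exact hxt (hmem i hik)
            subst this
            exact hyx.trans (hbot i _)
          · exact hyx.trans (htop k j x hjk.symm hxs).le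
  have hleft : Even (∑ t ∈ A.erase t₀, #(R.bipartiteAbove (fun t S => t ⊆ S) t)) := by
    refine Finset.even_sum _ fun t ht => ?_
    obtain ⟨htne, htA⟩ := Finset.mem_erase.1 ht
    obtain ⟨htc, hti⟩ := (hA t).1 htA
    -- A non-slack `y ∈ t` suffices for the parity lemma: `s j` lies above it in every order other
    -- than `j`.
    obtain ⟨y, hy, hys⟩ : ∃ y ∈ t, y ∉ range s := by
      by_contra! hall
      refine htne (Finset.eq_of_subset_of_card_le (fun y hy => ?_) ?_)
      · obtain ⟨i, rfl⟩ := hall y hy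
        refine mem_image_of_mem s ?_
        rw [← hti]
        exact Finset.mem_image.2 ⟨_, hy, hcs i⟩
      · have := ((hA t₀).1 ht₀A).1
        omega
    exact even_card_dominant_supersets r hr t ⟨y, hy⟩ htc
      (fun j => ⟨s j, fun i hij => ⟨y, hy, htop i j y hij hys⟩⟩) R hR
  rw [← add_sum_erase _ _ ht₀A, hodd] at hcount
  rw [← hcount] at hright
  obtain ⟨p, hp⟩ := hright
  obtain ⟨q, hq⟩ := hleft
  omega

/-! ### From Scarf's lemma to grid colourings -/

/-- The order on vertices of a subdivided simplex (with slack vertices) given by the `i`-th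
coordinate. -/
def gridCoord {I : Type*} [DecidableEq I] {T : Set (I → ℕ)} (N : ℕ) (i : I) : T ⊕ I → ℕ
  | Sum.inl x => x.1 i + 1
  | Sum.inr j => if j = i then 0 else N + 2

/-- For every colouring of the grid points of the `N`-fold simplex, some grid point `w` is close to
a point of each colour `i` for which `w i` is not small. -/
theorem exists_grid_point_near_colors {I : Type*} [Fintype I] [Nonempty I] (N : ℕ)
    (c : (I → ℕ) → I) :
    ∃ w : I → ℕ, ∑ i, w i = N ∧ ∀ i, w i ≤ Fintype.card I ∨
      ∃ x : I → ℕ, ∑ i, x i = N ∧ c x = i ∧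
        ∀ j, x j ≤ w j + Fintype.card I ∧ w j ≤ x j + Fintype.card I := by
  classical
  let T : Set (I → ℕ) := {x | ∑ i, x i = N}
  have hTfin : T.Finite := by
    refine (Finset.finite_toSet (Finset.piAntidiag Finset.univ N)).subset fun x hx => ?_
    simpa using (show ∑ i, x i = N from hx)
  have : Fintype T := hTfin.fintype
  let e := Fintype.equivFin (T ⊕ I)
  -- The second component breaks ties. Grid points have values in `1, …, N + 1`, strictly between
  -- the slack values `0` and `N + 2`.
  let r : I → T ⊕ I → ℕ ×ₗ Fin (Fintype.card (T ⊕ I)) := fun i v => toLex (gridCoord N i v, e v)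
  have hrle : ∀ i u v, r i u ≤ r i v → gridCoord N i u ≤ gridCoord N i v := by
    intro i u v h
    rcases (Prod.Lex.toLex_le_toLex).1 h with h | h
    · exact h.le
    · exact h.1.le
  have hrlt : ∀ i u v, gridCoord N i u < gridCoord N i v → r i u < r i v := fun i u v h =>
    Prod.Lex.toLex_lt_toLex.2 (Or.inl h)
  have hTle : ∀ (x : T) i, x.1 i ≤ N := fun x i => by
    have h := Finset.single_le_sum (f := x.1) (fun j _ => Nat.zero_le _) (Finset.mem_univ i)
    have h2 : ∑ i, x.1 i = N := x.2
    omega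
  obtain ⟨i₁⟩ := ‹Nonempty I›
  have : Nonempty I := ⟨i₁⟩
  let y₀ : T := ⟨Pi.single i₁ N, by simp [T]⟩
  obtain ⟨S, hS, hSc⟩ := exists_dominant_image_eq_univ r
    (fun i u v h => e.injective (congrArg (fun z => (ofLex z).2) h))
    Sum.inr (Sum.elim (fun x : T => c x.1) id) (fun i => rfl)
    (by
      intro i v
      by_cases hv : v = Sum.inr i
      · rw [hv]
      · refine (hrlt i _ _ ?_).le
        rcases v with x | j
        · simp [gridCoord]
        · have : j ≠ i := fun h => hv (by rw [h])
          simp [gridCoord, this])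
    (by
      rintro i j (x | k) hij hv
      · refine hrlt i _ _ ?_
        have := hTle x i
        simp only [gridCoord, if_neg hij.symm]
        omega
      · exact absurd ⟨k, rfl⟩ hv)
    (Sum.inl y₀) (by simp)
  have hdom : ∀ y : T, ∃ i, Sum.inr i ∉ S ∧ ∀ x : T, Sum.inl x ∈ S → y.1 i ≤ x.1 i := by
    intro y
    obtain ⟨i, hi⟩ := hS (Sum.inl y)
    refine ⟨i, fun h => ?_, fun x hx => ?_⟩
    · have := hrle _ _ _ (hi _ h)
      simp [gridCoord] at this
    · simpa [gridCoord] using hrle _ _ _ (hi _ hx)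
  have hcol : ∀ i, Sum.inr i ∉ S → ∃ x : T, Sum.inl x ∈ S ∧ c x.1 = i := by
    intro i hi
    have : i ∈ S.image (Sum.elim (fun x : T => c x.1) id) := hSc ▸ Finset.mem_univ i
    obtain ⟨v, hv, hvi⟩ := Finset.mem_image.1 this
    rcases v with x | j
    · exact ⟨x, hv, hvi⟩
    · exact absurd (by simpa using hvi ▸ hv) hi
  obtain ⟨i₀, hi₀, -⟩ := hdom y₀
  obtain ⟨w, hw, -⟩ := hcol i₀ hi₀
  have hmin : ∀ i, ∃ q : T, Sum.inl q ∈ S ∧ ∀ z : T, Sum.inl z ∈ S → q.1 i ≤ z.1 i := by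
    intro i
    obtain ⟨q, hq, hmin⟩ := (Finset.univ.filter fun z : T => Sum.inl z ∈ S).exists_min_image
      (fun z => z.1 i) ⟨w, by simpa using hw⟩
    exact ⟨q, by simpa using hq, fun z hz => hmin z (by simpa using hz)⟩
  choose q hq hqmin using hmin
  set m : I → ℕ := fun i => (q i).1 i with hm
  set C : Finset I := Finset.univ.filter fun i => Sum.inr i ∉ S with hC
  have hi₀C : i₀ ∈ C := by simpa [hC] using hi₀
  -- Otherwise raising every minimum on `C` by one, with the leftover put on `i₀`, gives a grid
  -- point violating dominance. Hence grid points of `S` exceed the minima by less than `C.card` in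
  -- total.
  have hsum : N < ∑ i ∈ C, (m i + 1) := by
    by_contra! hle
    let y : I → ℕ := fun i => (if i ∈ C then m i + 1 else 0) +
      if i = i₀ then N - ∑ i ∈ C, (m i + 1) else 0
    have hy : ∑ i, y i = N := by
      simp only [y, Finset.sum_add_distrib, Finset.sum_ite_mem, Finset.univ_inter,
        Finset.sum_ite_eq', Finset.mem_univ, if_true] at hle ⊢
      omega
    obtain ⟨i, hi, hmi⟩ := hdom ⟨y, hy⟩
    have h1 : y i ≤ m i := hmi _ (hq i)
    have hiC : i ∈ C := by simpa [hC] using hi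
    simp only [y, if_pos hiC] at h1
    omega
  rw [Finset.sum_add_distrib, Finset.sum_const, smul_eq_mul, mul_one] at hsum
  have hCc : C.card ≤ Fintype.card I := Finset.card_le_univ C
  have hbound : ∀ x : T, Sum.inl x ∈ S → ∀ i,
      (i ∈ C → m i ≤ x.1 i ∧ x.1 i ≤ m i + Fintype.card I) ∧
      (i ∉ C → x.1 i ≤ Fintype.card I) := by
    intro x hx i
    have hxN : ∑ i, x.1 i = N := x.2
    have hmx : ∀ i, m i ≤ x.1 i := fun i => hqmin i x hx
    constructor
    · intro hi
      refine ⟨hmx i, ?_⟩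
      have h1 : ∑ j ∈ C, x.1 j ≤ N :=
        hxN ▸ Finset.sum_le_sum_of_subset (Finset.subset_univ C)
      have h2 : ∑ j ∈ C.erase i, m j ≤ ∑ j ∈ C.erase i, x.1 j :=
        Finset.sum_le_sum fun j _ => hmx j
      rw [← Finset.add_sum_erase _ _ hi] at h1 hsum
      omega
    · intro hi
      have h1 : ∑ j ∈ insert i C, x.1 j ≤ N :=
        hxN ▸ Finset.sum_le_sum_of_subset (Finset.subset_univ _)
      rw [Finset.sum_insert hi] at h1
      have h2 : ∑ j ∈ C, m j ≤ ∑ j ∈ C, x.1 j := Finset.sum_le_sum fun j _ => hmx j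
      omega
  refine ⟨w.1, w.2, fun i => ?_⟩
  by_cases hi : i ∈ C
  · right
    obtain ⟨x, hx, hxi⟩ := hcol i (by simpa [hC] using hi)
    refine ⟨x.1, x.2, hxi, fun j => ?_⟩
    have hxj := hbound x hx j
    have hwj := hbound w hw j
    by_cases hj : j ∈ C
    · have := hxj.1 hj
      have := hwj.1 hj
      omega
    · have := hxj.2 hj
      have := hwj.2 hj
      omega
  · exact Or.inl ((hbound w hw i).2 hi)

/-! ### The KKM lemma on the simplex -/

open Filter Topology in
/-- A closed cover of the simplex indexed by its vertices has a point lying in every set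
corresponding to a non-vanishing coordinate. -/
theorem exists_mem_of_coord_ne_zero_of_closed_cover {I : Type*} [Fintype I] [Nonempty I]
    (A : I → Set (I → ℝ)) (hA : ∀ i, IsClosed (A i)) (hcov : ∀ x ∈ stdSimplex ℝ I, ∃ i, x ∈ A i) :
    ∃ x ∈ stdSimplex ℝ I, ∀ i, x i = 0 ∨ x ∈ A i := by
  set n : ℕ := Fintype.card I with hn
  let g : ℕ → (I → ℕ) → I → ℝ := fun k x i => x i / ((k : ℝ) + 1)
  have hg : ∀ k x, ∑ i, x i = k + 1 → g k x ∈ stdSimplex ℝ I := by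
    intro k x hx
    refine ⟨fun i => by positivity, ?_⟩
    simp only [g]
    rw [← Finset.sum_div, div_eq_one_iff_eq (by positivity)]
    exact_mod_cast hx
  have hstep : ∀ k : ℕ, ∃ w ∈ stdSimplex ℝ I, ∀ i, w i ≤ n / ((k : ℝ) + 1) ∨
      ∃ x ∈ A i, dist w x ≤ n / ((k : ℝ) + 1) := by
    intro k
    have hc : ∀ x : I → ℕ, ∃ i, ∑ i, x i = k + 1 → g k x ∈ A i := by
      intro x
      by_cases hx : ∑ i, x i = k + 1
      · exact (hcov _ (hg k x hx)).imp fun i hi _ => hi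
      · exact ⟨Classical.arbitrary I, fun h => absurd h hx⟩
    choose c hc using hc
    obtain ⟨w, hw, hwc⟩ := exists_grid_point_near_colors (k + 1) c
    refine ⟨g k w, hg k w hw, fun i => (hwc i).imp (fun h => ?_) ?_⟩
    · simp only [g]
      gcongr
    · rintro ⟨x, hx, rfl, hxw⟩
      refine ⟨g k x, hc x hx, (dist_pi_le_iff (by positivity)).2 fun j => ?_⟩
      rw [Real.dist_eq]
      simp only [g]
      rw [← sub_div, abs_div, abs_of_pos (by positivity : (0 : ℝ) < (k : ℝ) + 1)]
      gcongr
      obtain ⟨h1, h2⟩ := hxw j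
      have h1' : (x j : ℝ) ≤ w j + n := by exact_mod_cast h1
      have h2' : (w j : ℝ) ≤ x j + n := by exact_mod_cast h2
      rw [abs_le]
      constructor <;> linarith
  choose w hw hwA using hstep
  obtain ⟨a, ha, φ, hφ, hlim⟩ := (isCompact_stdSimplex ℝ I).tendsto_subseq hw
  refine ⟨a, ha, fun i => or_iff_not_imp_left.2 fun hai => ?_⟩
  have hai' : 0 < a i := lt_of_le_of_ne (ha.1 i) (Ne.symm hai)
  rw [← (hA i).closure_eq, Metric.mem_closure_iff]
  intro ε hε
  -- The bound `a i / 2` rules out the small-coordinate alternative near `a`; `ε / 2` pays for each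
  -- of two distances.
  have hδ : 0 < min (ε / 2) (a i / 2) := by positivity
  set δ := min (ε / 2) (a i / 2)
  have h1 : ∀ᶠ k in atTop, dist (w (φ k)) a < δ := Metric.tendsto_nhds.1 hlim δ hδ
  have h2 : Tendsto (fun k : ℕ => (n : ℝ) / ((k : ℝ) + 1)) atTop (𝓝 0) := by
    have := (tendsto_one_div_add_atTop_nhds_zero_nat (𝕜 := ℝ)).const_mul (n : ℝ)
    simpa [div_eq_mul_inv] using this
  have h3 := (h2.comp hφ.tendsto_atTop).eventually (gt_mem_nhds hδ)
  obtain ⟨k, hk1, hk2⟩ := (h1.and h3).exists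
  simp only [Function.comp_apply] at hk2
  have hδ1 : δ ≤ ε / 2 := min_le_left _ _
  have hδ2 : δ ≤ a i / 2 := min_le_right _ _
  rcases hwA (φ k) i with h | ⟨x, hx, hxw⟩
  · have h4 := (dist_le_pi_dist (w (φ k)) a i).trans_lt hk1
    rw [Real.dist_eq, abs_lt] at h4
    linarith
  · refine ⟨x, hx, ?_⟩
    have := dist_triangle_left a x (w (φ k))
    linarith

/-- The **Knaster–Kuratowski–Mazurkiewicz lemma** on the standard simplex. -/
theorem knaster_kuratowski_mazurkiewicz {I : Type*} [Fintype I] [Nonempty I]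
    (A : I → Set (I → ℝ)) (hA : ∀ i, IsClosed (A i))
    (hcov : ∀ x ∈ stdSimplex ℝ I, ∃ i, x i ≠ 0 ∧ x ∈ A i) :
    ∃ x ∈ stdSimplex ℝ I, ∀ i, x ∈ A i := by
  classical
  by_contra! hcon
  -- Needed because `Metric.infDist` to the empty set is `0`.
  have hne : ∀ i, (A i).Nonempty := by
    intro i
    obtain ⟨j, hj, hjA⟩ := hcov _ (single_mem_stdSimplex ℝ i)
    have : j = i := by
      by_contra h
      exact hj (by simp [h])
    exact ⟨_, this ▸ hjA⟩
  set s : (I → ℝ) → ℝ := fun x => ∑ i, Metric.infDist x (A i) with hs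
  have hscont : Continuous s :=
    continuous_finsetSum _ fun i _ => Metric.continuous_infDist_pt (A i)
  have hspos : ∀ x ∈ stdSimplex ℝ I, 0 < s x := by
    intro x hx
    obtain ⟨i, hi⟩ := hcon x hx
    refine Finset.sum_pos' (fun j _ => Metric.infDist_nonneg) ⟨i, Finset.mem_univ i, ?_⟩
    exact ((hA i).notMem_iff_infDist_pos (hne i)).1 hi
  -- These sets cover, since both sides of the inequality sum to `s x`. At the point found, an `i`
  -- with `x i ≠ 0` and `x ∈ A i` would force `x i * s x ≤ 0`.
  obtain ⟨x, hx, hxB⟩ := exists_mem_of_coord_ne_zero_of_closed_cover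
    (fun i => {x | x i * s x ≤ Metric.infDist x (A i)})
    (fun i => isClosed_le ((continuous_apply i).mul hscont) (Metric.continuous_infDist_pt (A i)))
    (by
      intro x hx
      by_contra! h
      have h1 : ∑ i, Metric.infDist x (A i) < ∑ i, x i * s x :=
        Finset.sum_lt_sum_of_nonempty Finset.univ_nonempty fun i _ => not_le.1 (h i)
      rw [← Finset.sum_mul, hx.2, one_mul] at h1
      exact lt_irrefl _ h1)
  obtain ⟨i, hi, hiA⟩ := hcov x hx
  have h1 : x i * s x ≤ Metric.infDist x (A i) := (hxB i).resolve_left hi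
  rw [Metric.infDist_zero_of_mem hiA] at h1
  have h2 : 0 < x i := lt_of_le_of_ne (hx.1 i) (Ne.symm hi)
  exact absurd h1 (not_le.2 (mul_pos h2 (hspos x hx)))

/-! ### Semicontinuity, segment-density and concavity -/

theorem UpperHemicontinuousWithinAt.eventually_subset {α β : Type*} [TopologicalSpace α]
    [TopologicalSpace β] {f : α → Set β} {s : Set α} {x : α} (h : UpperHemicontinuousWithinAt f s x)
    {N : Set β} (hN : IsOpen N) (hx : f x ⊆ N) : ∀ᶠ z in nhdsWithin x s, f z ⊆ N :=
  (h N (hN.mem_nhdsSet.2 hx)).mono fun _ hz => subset_of_mem_nhdsSet hz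

/-- Missing `Ici a` means lying in the open set `Iio a`, which persists at nearby points of `K`. -/
theorem UpperHemicontinuousOn.isClosed_setOf_inter_Ici_nonempty {α : Type*} [TopologicalSpace α]
    {f : α → Set ℝ} {K : Set α} (h : UpperHemicontinuousOn f K) (hK : IsClosed K) (a : ℝ) :
    IsClosed {x | x ∈ K ∧ (f x ∩ Ici a).Nonempty} := by
  refine isClosed_of_closure_subset fun x hx => ?_
  have hxK : x ∈ K := closure_minimal (fun _ hy => hy.1) hK hx
  refine ⟨hxK, ?_⟩
  by_contra hne
  have hsub : f x ⊆ Iio a := fun r hr => mem_Iio.2 (lt_of_not_ge fun har => hne ⟨r, hr, mem_Ici.2 har⟩)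
  have hev := UpperHemicontinuousWithinAt.eventually_subset (h x hxK) isOpen_Iio hsub
  rw [eventually_nhdsWithin_iff] at hev
  obtain ⟨z, hz, hzK, r, hr, har⟩ := ((mem_closure_iff_frequently.1 hx).and_eventually hev).exists.imp
    fun z hz => (⟨hz.2 hz.1.1, hz.1⟩ : f z ⊆ Iio a ∧ z ∈ K ∧ (f z ∩ Ici a).Nonempty)
  exact not_lt.2 (mem_Ici.1 har) (mem_Iio.1 (hz hr))

/-- A self segment-dense set is dense in every polytope spanned by its points. -/
theorem SelfSegmentDense.convexHull_subset_closure {E : Type*} [AddCommGroup E] [Module ℝ E]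
    [TopologicalSpace E] [IsTopologicalAddGroup E] [ContinuousSMul ℝ E] {D K : Set E}
    (hD : SelfSegmentDense D K) (s : Finset E) (hs : (s : Set E) ⊆ D) :
    convexHull ℝ (s : Set E) ⊆ closure (convexHull ℝ (s : Set E) ∩ D) := by
  classical
  induction s using Finset.induction_on with
  | empty => simp
  | insert a s ha ih =>
    rw [Finset.coe_insert, insert_subset_iff] at hs
    rw [Finset.coe_insert]
    rcases s.eq_empty_or_nonempty with rfl | hne
    · simpa [hs.1] using subset_closure (s := ({a} : Set E)) (mem_singleton a)
    rw [convexHull_insert (by simpa using hne)]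
    intro x hx
    obtain ⟨b, rfl, w, hw, p, q, hp, hq, hpq, rfl⟩ := mem_convexJoin.1 hx
    -- Two approximations: `w` by some `z ∈ D`, then the point of `[b, z]` by points of `D` on that
    -- segment.
    rw [← closure_closure]
    refine map_mem_closure (f := fun w => p • b + q • w) (by fun_prop) (ih hs.2 hw) ?_
    rintro z ⟨hz, hzD⟩
    refine closure_mono ?_ (hD.2.2 b hs.1 z hzD ⟨p, q, hp, hq, hpq, rfl⟩)
    exact inter_subset_inter_left _ fun v hv =>
      mem_convexJoin.2 ⟨b, rfl, z, hz, hv⟩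

/-- A convex combination of negative numbers is negative, because some weight is positive. -/
theorem SetValuedConcaveOn.exists_inter_Ici_nonempty {E : Type*} [AddCommGroup E] [Module ℝ E]
    {D : Set E} {T : E → Set ℝ} (hT : SetValuedConcaveOn D T) (s : Finset E)
    (hs : (s : Set E) ⊆ D) {x : E} (hx : x ∈ convexHull ℝ (s : Set E)) (hxD : x ∈ D)
    (h0 : (T x ∩ Ici (0 : ℝ)).Nonempty) : ∃ y ∈ s, (T y ∩ Ici (0 : ℝ)).Nonempty := by
  obtain ⟨w, hw0, hw1, hwx⟩ := Finset.mem_convexHull'.1 hx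
  let e := s.equivFin.symm
  have hsum1 : ∑ i, w (e i) = 1 := by
    rw [Equiv.sum_comp e (fun y : s => w y), Finset.sum_coe_sort s w, hw1]
  have hsumx : ∑ i, w (e i) • ((e i : s) : E) = x := by
    rw [Equiv.sum_comp e (fun y : s => w y • (y : E)), Finset.sum_coe_sort s fun y => w y • y, hwx]
  have hsub := hT s.card (fun i => (e i : E)) (fun i => w (e i)) (fun i => hs (e i).2)
    (fun i => hw0 _ (e i).2) hsum1 (hsumx.symm ▸ hxD)
  rw [hsumx] at hsub
  obtain ⟨r, hr, hr0⟩ := h0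
  obtain ⟨g, hg, hgr⟩ := (mem_fintype_sum _ _).1 (hsub hr)
  by_contra! hcon
  have hneg : ∀ i, g i ≤ 0 ∧ (w (e i) ≠ 0 → g i < 0) := by
    intro i
    obtain ⟨t, ht, hti⟩ := mem_smul_set.1 (hg i)
    have ht0 : t < 0 := by
      by_contra! h
      have : t ∈ T (e i) ∩ Ici (0 : ℝ) := ⟨ht, h⟩
      rw [hcon _ (e i).2] at this
      exact this
    have hwi := hw0 _ (e i).2
    rw [← hti, smul_eq_mul]
    exact ⟨mul_nonpos_of_nonneg_of_nonpos hwi ht0.le,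
      fun h => mul_neg_of_pos_of_neg (lt_of_le_of_ne hwi h.symm) ht0⟩
  obtain ⟨i, -, hi⟩ := Finset.exists_ne_zero_of_sum_ne_zero (hsum1.trans_ne one_ne_zero)
  have : ∑ i, g i < 0 := Finset.sum_neg' (fun i _ => (hneg i).1) ⟨i, Finset.mem_univ i, (hneg i).2 hi⟩
  rw [hgr] at this
  exact absurd hr0 (not_le.2 this)

/-! ### The KKM principle and the equilibrium point -/

/-- The finite **KKM principle** in a topological vector space. -/
theorem iInter_nonempty_of_convexHull_subset {E I : Type*} [AddCommGroup E] [Module ℝ E]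
    [TopologicalSpace E] [IsTopologicalAddGroup E] [ContinuousSMul ℝ E] [Fintype I] [Nonempty I]
    (v : I → E) (G : I → Set E) (hG : ∀ i, IsClosed (G i))
    (hcov : ∀ J : Finset I, convexHull ℝ (v '' J) ⊆ ⋃ i ∈ J, G i) : (⋂ i, G i).Nonempty := by
  classical
  let φ : (I → ℝ) → E := fun x => ∑ i, x i • v i
  have hφ : Continuous φ := by fun_prop
  obtain ⟨x, -, hx⟩ := knaster_kuratowski_mazurkiewicz (fun i => φ ⁻¹' G i)
    (fun i => (hG i).preimage hφ) (by
      intro x hx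
      -- Restricting to the support of `x` ensures that the covering index has nonzero coordinate.
      have hmem : φ x ∈ convexHull ℝ (v '' (Finset.univ.filter fun i => x i ≠ 0 : Finset I)) := by
        have h1 : φ x = ∑ i ∈ Finset.univ.filter (fun i => x i ≠ 0), x i • v i := by
          symm
          apply Finset.sum_filter_of_ne
          intro i _ h hi
          exact h (by rw [hi, zero_smul])
        have h2 : ∑ i ∈ Finset.univ.filter (fun i => x i ≠ 0), x i = 1 :=
          (Finset.sum_filter_ne_zero Finset.univ).trans hx.2
        rw [h1]
        exact (convex_convexHull ℝ _).sum_mem (fun i _ => hx.1 i) h2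
          fun i hi => subset_convexHull ℝ _ (mem_image_of_mem v hi)
      obtain ⟨i, hi, hiG⟩ := mem_iUnion₂.1 (hcov _ hmem)
      exact ⟨i, (Finset.mem_filter.1 hi).2, hiG⟩)
  exact ⟨φ x, mem_iInter.2 hx⟩

theorem theorem3p5 {X : Type*} [AddCommGroup X] [Module ℝ X] [TopologicalSpace X]
    [IsTopologicalAddGroup X] [ContinuousSMul ℝ X] [LocallyConvexSpace ℝ X] [T2Space X]
    (K D : Set X) (hK_ne : K.Nonempty) (hK_conv : Convex ℝ K) (hK_comp : IsCompact K)
    (hD : SelfSegmentDense D K)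
    -- only the values of `F` on `K × K` matter; empty values are allowed
    (F : X → X → Set ℝ)
    (h_usc_left : ∀ y ∈ D, UpperHemicontinuousOn (fun x => F x y) K)
    (h_usc_right : ∀ x ∈ K, ∀ y ∈ K \ D, UpperHemicontinuousWithinAt (fun z => F x z) K y)
    (h_concave : ∀ x ∈ D, SetValuedConcaveOn D (fun y => F x y))
    (h_diag : ∀ x ∈ D, (F x x ∩ Set.Ici (0 : ℝ)).Nonempty) :
    ∃ x₀ ∈ K, ∀ y ∈ K, (F x₀ y ∩ Set.Ici (0 : ℝ)).Nonempty := by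
  classical
  let G : X → Set X := fun y => {x | x ∈ K ∧ (F x y ∩ Ici (0 : ℝ)).Nonempty}
  have hG : ∀ y ∈ D, IsClosed (G y) := fun y hy =>
    (h_usc_left y hy).isClosed_setOf_inter_Ici_nonempty hK_comp.isClosed 0
  have hcov : ∀ s : Finset X, (s : Set X) ⊆ D → convexHull ℝ (s : Set X) ⊆ ⋃ y ∈ s, G y := by
    intro s hs
    refine (hD.convexHull_subset_closure s hs).trans (closure_minimal ?_
      (s.finite_toSet.isClosed_biUnion fun y hy => hG y (hs hy)))
    rintro x ⟨hx, hxD⟩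
    obtain ⟨y, hy, hyx⟩ := (h_concave x hxD).exists_inter_Ici_nonempty s hs hx hxD (h_diag x hxD)
    exact mem_iUnion₂.2 ⟨y, hy, hD.1 hxD, hyx⟩
  obtain ⟨x₀, hx₀, hx₀G⟩ := hK_comp.inter_iInter_nonempty (fun y : D => G y)
    (fun y => hG y y.2) (by
      intro u
      rcases u.eq_empty_or_nonempty with rfl | hu
      · simpa using hK_ne
      have : Nonempty u := hu.to_subtype
      obtain ⟨x, hx⟩ := iInter_nonempty_of_convexHull_subset (I := u) (fun y => (y : X))
        (fun y => G y) (fun y => hG y y.1.2) (by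
          intro J
          have h := hcov (J.image fun y : u => (y.1 : X)) (by
            intro z hz
            obtain ⟨y, -, rfl⟩ := Finset.mem_image.1 (Finset.mem_coe.1 hz)
            exact y.1.2)
          rw [Finset.coe_image, Finset.set_biUnion_finset_image] at h
          exact h)
      rw [mem_iInter] at hx
      obtain ⟨y, hy⟩ := hu
      exact ⟨x, (hx ⟨y, hy⟩).1, mem_iInter₂.2 fun z hz => hx ⟨z, hz⟩⟩)
  rw [mem_iInter] at hx₀G
  refine ⟨x₀, hx₀, fun y hy => ?_⟩
  by_cases hyD : y ∈ D
  · exact (hx₀G ⟨y, hyD⟩).2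
  by_contra hne
  -- Failure at `y` would spread to nearby points of `K`, among them points of `D`, where it is
  -- excluded.
  have hsub : F x₀ y ⊆ Iio 0 := fun r hr => mem_Iio.2 (lt_of_not_ge fun har => hne ⟨r, hr, mem_Ici.2 har⟩)
  have hev := (h_usc_right x₀ hx₀ y ⟨hy, hyD⟩).eventually_subset isOpen_Iio hsub
  rw [eventually_nhdsWithin_iff] at hev
  obtain ⟨z, hzD, hz⟩ := ((mem_closure_iff_frequently.1 (hD.2.1 hy)).and_eventually hev).exists
  obtain ⟨r, hr, hr0⟩ := (hx₀G ⟨z, hzD⟩).2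
  exact not_lt.2 (mem_Ici.1 hr0) (mem_Iio.1 (hz (hD.1 hzD) hr))
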